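/- A random geometric graph on $\mathbb{R}$ is a random graph $G=(V,E)$ whose vertex set $V$ is a countable random subset of $\mathbb{R}$ and whose edge set $E$ is a random set of unordered pairs of distinct elements of $V$. A connected component (cluster) of $G$ is called recurrent if all its vertices have finite degree and, for each of its vertices $x$, simple random walk on $G$ started at $x$ almost surely returns to $x$ (a cluster consisting of a single isolated vertex counts as recurrent); otherwise it is transient. **Lemma.** Let $G=(V,E)$ be a random geometric graph on $\mathbb{R}$ whose vertex set is almost surely locally finite, i.e. almost surely $V\cap[a,b]$ is finite for all real $a\le b$. Suppose that, for some non-trivial subgroup $H\neq\{0\}$ of $(\mathbb{R},+)$, the distribution of $G$ is invariant and ergodic under the translations by elements of $H$. Let $$\mathsf{X}=\sum_{x\in V:\,x\le 0}\ \sum_{y\in V:\,y>0}\mathbf{1}\{xy\in E\}$$ be the number of edges of $G$ crossing over $0+$. If $\mathbb{P}(\mathsf{X}<\infty)>0$, then almost surely all clusters of $G$ are recurrent. -/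

import Mathlib

open MeasureTheory ProbabilityTheory

/-! ### Simple random walk on a countable graph -/

section Walk

variable {W : Type*} [MeasurableSpace W] [DiscreteMeasurableSpace W]

/-- The law of one step of simple random walk from `x`: uniform on the neighbours of `x` if there
are finitely many and at least one of them; otherwise the walk stays put (this convention matters
only for isolated vertices, clusters with a vertex of infinite degree being transient below). -/
noncomputable def SimpleGraph.stepLaw {W : Type*} (G : SimpleGraph W) (x : W) : PMF W :=
  open Classical in
  if h : (G.neighborSet x).Finite ∧ (G.neighborSet x).Nonempty then
    PMF.uniformOfFinset h.1.toFinset (h.1.toFinset_nonempty.2 h.2)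
  else PMF.pure x

/-- The transition kernel of simple random walk. -/
noncomputable def SimpleGraph.stepKernel (G : SimpleGraph W) : Kernel W W where
  toFun x := (G.stepLaw x).toMeasure
  measurable' := Measurable.of_discrete

instance SimpleGraph.isMarkovKernel_stepKernel (G : SimpleGraph W) :
    IsMarkovKernel G.stepKernel :=
  ⟨fun x => PMF.toMeasure.isProbabilityMeasure (G.stepLaw x)⟩

/-- The Markovian transition at time `n`, as a kernel depending on the trajectory up to time `n`
only through its last position. -/
noncomputable def SimpleGraph.historyKernel (G : SimpleGraph W) (n : ℕ) :
    Kernel ((_ : Finset.Iic n) → W) W :=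
  G.stepKernel.comap (fun p => p ⟨n, Finset.mem_Iic.2 le_rfl⟩) (measurable_pi_apply _)

instance SimpleGraph.isMarkovKernel_historyKernel (G : SimpleGraph W) (n : ℕ) :
    IsMarkovKernel (G.historyKernel n) := by
  unfold SimpleGraph.historyKernel; infer_instance

/-- The law, on the space of trajectories, of simple random walk on `G` started at `x`. -/
noncomputable def SimpleGraph.walkLaw (G : SimpleGraph W) (x : W) : Measure (ℕ → W) :=
  Kernel.traj (X := fun _ => W) G.historyKernel 0 (fun _ => x)

/-- The cluster of `x` is recurrent: it is locally finite, and simple random walk started at `x`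
almost surely returns to `x`. -/
def SimpleGraph.ClusterRecurrent (G : SimpleGraph W) (x : W) : Prop :=
  (∀ y, G.Reachable x y → (G.neighborSet y).Finite) ∧
    ∀ᵐ X ∂(G.walkLaw x), ∃ n : ℕ, 1 ≤ n ∧ X n = x

end Walk

/-! ### Geometric graphs on the line -/

/-- A graph with a countable vertex set `verts ⊆ ℝ`. The edges are those of `graph`, a simple graph
on `ℝ` all of whose edges have their endpoints in `verts`. -/
structure GeometricGraph where
  verts : Set ℝ
  countable_verts : verts.Countable
  graph : SimpleGraph ℝ
  mem_of_adj : ∀ x y, graph.Adj x y → x ∈ verts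

namespace GeometricGraph

instance (g : GeometricGraph) : Countable g.verts := g.countable_verts.to_subtype

/-- The edges of `g`, as ordered pairs of adjacent points: each edge appears in both orientations. -/
def arcs (g : GeometricGraph) : Set (ℝ × ℝ) := {p | g.graph.Adj p.1 p.2}

/-- The σ-algebra generated by the numbers of vertices in Borel subsets of `ℝ` and the numbers
of oriented edges in Borel subsets of `ℝ × ℝ`. -/
noncomputable instance : MeasurableSpace GeometricGraph :=
  (⨆ (A : Set ℝ) (_ : MeasurableSet A),
      MeasurableSpace.comap (fun g : GeometricGraph => (g.verts ∩ A).encard) ⊤) ⊔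
    (⨆ (B : Set (ℝ × ℝ)) (_ : MeasurableSet B),
      MeasurableSpace.comap (fun g : GeometricGraph => (g.arcs ∩ B).encard) ⊤)

/-- The graph moved by `h`: it has the vertices `x + h` and edges between `x + h` and `y + h`,
for vertices `x` and edges `xy` of `g`. -/
def translate (h : ℝ) (g : GeometricGraph) : GeometricGraph where
  verts := {x | x - h ∈ g.verts}
  countable_verts := g.countable_verts.preimage (sub_left_injective (b := h))
  graph := g.graph.comap (fun x => x - h)
  mem_of_adj x y hxy := g.mem_of_adj (x - h) (y - h) hxy

/-- The vertex set has finitely many points in every bounded interval. -/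
def LocallyFiniteVerts (g : GeometricGraph) : Prop :=
  ∀ a b : ℝ, (g.verts ∩ Set.Icc a b).Finite

/-- The number of edges above `0+`: edges `xy` with `x ≤ 0 < y`. -/
noncomputable def crossings (g : GeometricGraph) : ℕ∞ :=
  {p : ℝ × ℝ | p.1 ≤ 0 ∧ 0 < p.2 ∧ g.graph.Adj p.1 p.2}.encard

/-- All clusters of `g` are recurrent; the walk lives on the vertex set of `g`. -/
def AllClustersRecurrent (g : GeometricGraph) : Prop :=
  ∀ x : g.verts, (g.graph.induce g.verts).ClusterRecurrent x

/-- The law `ν` of a random geometric graph is invariant under the translations in `H`. -/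
def TranslationInvariant (H : AddSubgroup ℝ) (ν : Measure GeometricGraph) : Prop :=
  ∀ h ∈ H, MeasurePreserving (translate h) ν ν

/-- The probability law `ν` is ergodic under the translations in `H`: every event that is
invariant under all of them has probability `0` or `1`. -/
def TranslationErgodic (H : AddSubgroup ℝ) (ν : Measure GeometricGraph) : Prop :=
  ∀ A : Set GeometricGraph, MeasurableSet A → (∀ h ∈ H, translate h ⁻¹' A = A) →
    ν A = 0 ∨ ν A = 1

end GeometricGraph

/-! For some finite `M`, at most `M` edges cross `0+` with positive probability. Fix `h > 0` in `H`.
Poincaré recurrence for the translations by `h` and by `-h` turns this, with positive probability,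
into arbitrarily far points on both sides of the line that at most `M` edges cross. Having such
points for some `M` is a translation-invariant event, so by ergodicity it is almost sure
(`ae_hasThinPlaces`). The finitely many vertices between a far left and a far right such point have
at most `2 * M` edges leaving them, so every finite vertex set lies in a finite set with bounded
edge boundary (`HasThinPlaces.hasSmallCuts`).

Such a graph is recurrent by Nash-Williams, proved here without electrical networks. Let `v` be the
probability of never hitting `o` at a positive time. The function `u = 2 - v`, reset to `2` at `o`,
is positive and superharmonic, and its Laplacian at `o` is `deg o * v o`. Testing it against `φ ^ 2
/ u`, where `φ` counts membership in `N` nested sets with disjoint boundaries of size at most `C`,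
bounds `N ^ 2` times this Laplacian by `C * N * u o`. Letting `N → ∞` gives `v o = 0`
(`HasSmallCuts.harmonic_of_superharmonic`). -/

/-! ### Simple random walk avoiding a vertex -/

section Walk

open scoped ENNReal

variable {W : Type*} [MeasurableSpace W] [DiscreteMeasurableSpace W]

namespace SimpleGraph

variable (G : SimpleGraph W)

/-- Under the law of simple random walk, the conditional law of the next position given the past is
the transition kernel at the current position. -/
lemma lintegral_walkLaw_succ (x : W) (n : ℕ) (F : ((_ : Finset.Iic n) → W) → ℝ≥0∞)
    (hF : Measurable F) (f : W → ℝ≥0∞) :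
    ∫⁻ X, F (Preorder.frestrictLe n X) * f (X (n + 1)) ∂(G.walkLaw x) =
      ∫⁻ X, F (Preorder.frestrictLe n X) * ∫⁻ z, f z ∂(G.stepKernel (X n)) ∂(G.walkLaw x) := by
  have hf : Measurable f := Measurable.of_discrete
  have h := Kernel.partialTraj_compProd_eq_map_traj (X := fun _ => W) (κ := G.historyKernel)
    (Nat.zero_le n) (x₀ := fun _ => x)
  rw [← Kernel.traj_map_frestrictLe_apply] at h
  have h2 := congrArg
    (fun μ => ∫⁻ p, (F p.1 * f p.2 : ℝ≥0∞) ∂μ) h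
  rw [lintegral_map (by fun_prop) (by fun_prop), Measure.lintegral_compProd (by fun_prop)] at h2
  simp only [lintegral_const_mul _ hf] at h2
  have hm : Measurable fun p => F p * ∫⁻ z, f z ∂(G.historyKernel n p) :=
    hF.mul hf.lintegral_kernel
  rw [lintegral_map hm (by fun_prop)] at h2
  exact h2.symm

/-- The transition operator of simple random walk killed at `o`. -/
noncomputable def killedStep (o : W) (f : W → ℝ≥0∞) (x : W) : ℝ≥0∞ :=
  ∫⁻ z, (({o}ᶜ : Set W).indicator f z) ∂(G.stepKernel x)

/-- By the Markov property, integrating out the last step replaces `f` by `killedStep o f`; hence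
the induction over all `f`. -/
lemma lintegral_walkLaw_avoid (o x : W) (n : ℕ) (f : W → ℝ≥0∞) :
    ∫⁻ X, {X : ℕ → W | ∀ k, 1 ≤ k → k ≤ n → X k ≠ o}.indicator (fun X => f (X n)) X
      ∂(G.walkLaw x) = (G.killedStep o)^[n] f x := by
  induction n generalizing f with
  | zero =>
    have h := Kernel.traj_map_frestrictLe_apply (X := fun _ => W) (κ := G.historyKernel) 0 0
      (fun _ => x)
    rw [Kernel.partialTraj_self, Kernel.id_apply] at h
    have h2 := congrArg
      (fun μ => ∫⁻ p, f (p ⟨0, Finset.mem_Iic.2 le_rfl⟩) ∂μ) h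
    have hf : Measurable f := Measurable.of_discrete
    rw [lintegral_map (by fun_prop) (by fun_prop), lintegral_dirac' _ (by fun_prop)] at h2
    have : {X : ℕ → W | ∀ k, 1 ≤ k → k ≤ 0 → X k ≠ o} = Set.univ := by
      ext X; simp only [Set.mem_ofPred_eq, Set.mem_univ, iff_true]; intros; omega
    rw [this]
    simpa only [Set.indicator_univ] using! h2
  | succ n ih =>
    rw [Function.iterate_succ_apply, ← ih]
    -- The avoidance event seen on the path up to time `n`; time `0` is unconstrained, so the walk
    -- may start at `o`.
    set A : Set ((_ : Finset.Iic n) → W) :=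
      ⋂ k : Finset.Iic n, {p | 1 ≤ k.1 → p k ≠ o} with hA
    have hAm : MeasurableSet A := by
      refine MeasurableSet.iInter fun k => ?_
      have : {p : (_ : Finset.Iic n) → W | 1 ≤ k.1 → p k ≠ o} =
          (fun p => p k) ⁻¹' {w | 1 ≤ k.1 → w ≠ o} := rfl
      rw [this]
      exact measurable_pi_apply k (MeasurableSet.of_discrete)
    have h := G.lintegral_walkLaw_succ x n (A.indicator 1) (measurable_one.indicator hAm)
      (({o}ᶜ : Set W).indicator f)
    have hmem' : ∀ (X : ℕ → W) m, X ∈ {X : ℕ → W | ∀ k, 1 ≤ k → k ≤ m → X k ≠ o} ↔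
        ∀ k, 1 ≤ k → k ≤ m → X k ≠ o := fun _ _ => Iff.rfl
    have hmem : ∀ X : ℕ → W, Preorder.frestrictLe (π := fun _ => W) n X ∈ A ↔
        ∀ k, 1 ≤ k → k ≤ n → X k ≠ o := by
      intro X
      simp only [hA, Set.mem_iInter, Set.mem_ofPred_eq, Subtype.forall, Finset.mem_Iic]
      exact ⟨fun h k h1 h2 => h k h2 h1, fun h k h2 h1 => h k h1 h2⟩
    refine Eq.trans (lintegral_congr fun X => ?_) (h.trans (lintegral_congr fun X => ?_))
    · by_cases h1 : ∀ k, 1 ≤ k → k ≤ n → X k ≠ o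
      · by_cases h2 : X (n + 1) = o
        · rw [Set.indicator_of_notMem, Set.indicator_of_notMem (s := {o}ᶜ) (by simpa using h2),
            mul_zero]
          exact fun h3 => (hmem' X _).1 h3 (n + 1) (by omega) le_rfl h2
        · rw [Set.indicator_of_mem, Set.indicator_of_mem ((hmem X).2 h1),
            Set.indicator_of_mem (s := {o}ᶜ) (by simpa using h2)]
          · simp
          · intro k hk hk'
            rcases Nat.lt_or_ge n k with h4 | h4
            · obtain rfl : k = n + 1 := by omega
              exact h2
            · exact h1 k hk h4
      · rw [Set.indicator_of_notMem (fun h3 => h1 fun k hk hk' => (hmem' X _).1 h3 k hk (by omega)),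
          Set.indicator_of_notMem (fun h3 => h1 ((hmem X).1 h3)), zero_mul]
    · by_cases h1 : ∀ k, 1 ≤ k → k ≤ n → X k ≠ o
      · rw [Set.indicator_of_mem ((hmem X).2 h1), Set.indicator_of_mem ((hmem' X n).2 h1)]
        simp [killedStep]
      · rw [Set.indicator_of_notMem (fun h3 => h1 ((hmem X).1 h3)), Set.indicator_of_notMem (mt (hmem' X n).1 h1),
          zero_mul]

/-- The limit, as `n → ∞`, of the probability that the walk from `x` avoids `o` at times
`1, …, n`. -/
noncomputable def avoidProb (o x : W) : ℝ≥0∞ := ⨅ n, (G.killedStep o)^[n] 1 x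

lemma killedStep_mono (o : W) : Monotone (G.killedStep o) := fun _ _ h _ =>
  lintegral_mono fun z => Set.indicator_le_indicator (h z)

lemma killedStep_one_le (o : W) : G.killedStep o 1 ≤ 1 := fun _ => by
  refine (lintegral_mono fun z => Set.indicator_le_self _ _ z).trans ?_
  simp

lemma antitone_iterate_killedStep (o : W) : Antitone fun n => (G.killedStep o)^[n] 1 :=
  (G.killedStep_mono o).antitone_iterate_of_map_le (G.killedStep_one_le o)

lemma avoidProb_le_one (o x : W) : G.avoidProb o x ≤ 1 := iInf_le_of_le 0 le_rfl

/-- Monotone convergence along the decreasing iterates, which are bounded by `1`: one more step only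
shifts the index of the infimum. -/
lemma killedStep_avoidProb (o : W) : G.killedStep o (G.avoidProb o) = G.avoidProb o := by
  funext x
  have h1 : ∀ z, ({o}ᶜ : Set W).indicator (G.avoidProb o) z =
      ⨅ n, ({o}ᶜ : Set W).indicator ((G.killedStep o)^[n] 1) z := by
    intro z
    by_cases hz : z ∈ ({o}ᶜ : Set W)
    · simp only [Set.indicator_of_mem hz, avoidProb]
    · simp only [Set.indicator_of_notMem hz, ciInf_const]
  unfold killedStep
  simp_rw [h1]
  rw [lintegral_iInf (f := fun n => ({o}ᶜ : Set W).indicator ((G.killedStep o)^[n] 1))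
    (fun n => Measurable.of_discrete)
    (fun m n hmn z => Set.indicator_le_indicator (G.antitone_iterate_killedStep o hmn z))]
  · refine le_antisymm (le_iInf fun n => ?_) (le_iInf fun n => ?_)
    · refine (iInf_le _ n).trans (le_of_eq_of_le ?_ (G.antitone_iterate_killedStep o n.le_succ x))
      simp only [Function.iterate_succ_apply']; rfl
    · refine (iInf_le _ (n + 1)).trans_eq ?_
      simp only [Function.iterate_succ_apply']; rfl
  · exact ((G.killedStep_one_le o x).trans_lt ENNReal.one_lt_top).ne

lemma ae_return_of_avoidProb_eq_zero {o : W} (h : G.avoidProb o o = 0) :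
    ∀ᵐ X ∂(G.walkLaw o), ∃ n : ℕ, 1 ≤ n ∧ X n = o := by
  rw [ae_iff, ← nonpos_iff_eq_zero, ← h]
  refine le_iInf fun n => ?_
  rw [← lintegral_walkLaw_avoid]
  have hm : MeasurableSet {X : ℕ → W | ∀ k, 1 ≤ k → k ≤ n → X k ≠ o} := by
    have : {X : ℕ → W | ∀ k, 1 ≤ k → k ≤ n → X k ≠ o} =
        ⋂ k, (fun X => X k) ⁻¹' {w | 1 ≤ k → k ≤ n → w ≠ o} := by ext X; simp
    rw [this]
    exact MeasurableSet.iInter fun k => measurable_pi_apply k MeasurableSet.of_discrete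
  refine (measure_mono ?_).trans_eq (lintegral_indicator_one hm).symm
  intro X hX k hk _ he
  exact hX ⟨k, hk, he⟩

/-- A step from a vertex of finite positive degree averages over the neighbours. -/
lemma lintegral_stepKernel {x : W} (hfin : (G.neighborSet x).Finite)
    (hne : (G.neighborSet x).Nonempty) (f : W → ℝ≥0∞) :
    (hfin.toFinset.card : ℝ≥0∞) * ∫⁻ z, f z ∂(G.stepKernel x) = ∑ z ∈ hfin.toFinset, f z := by
  have hne' := hfin.toFinset_nonempty.2 hne
  have h1 : G.stepLaw x = PMF.uniformOfFinset hfin.toFinset hne' := by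
    unfold stepLaw; rw [dif_pos ⟨hfin, hne⟩]
  have h0 : (hfin.toFinset.card : ℝ≥0∞) ≠ 0 := by
    simpa using hne'.ne_empty
  have h2 : G.stepKernel x = ∑ z ∈ hfin.toFinset,
      (hfin.toFinset.card : ℝ≥0∞)⁻¹ • Measure.dirac z := by
    change (G.stepLaw x).toMeasure = _
    classical
    ext s hs
    rw [h1, PMF.toMeasure_uniformOfFinset_apply _ _ hs]
    simp only [Measure.coe_finsetSum, Finset.sum_apply, Measure.smul_apply, smul_eq_mul,
      Measure.dirac_apply' _ hs, ← Finset.mul_sum]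
    rw [Finset.sum_indicator_eq_sum_filter]
    simp [ENNReal.div_eq_inv_mul]
  rw [h2, lintegral_finsetSum_measure]
  simp only [lintegral_smul_measure, lintegral_dirac, smul_eq_mul, ← Finset.mul_sum]
  rw [← mul_assoc, ENNReal.mul_inv_cancel h0 (ENNReal.natCast_ne_top _), one_mul]

/-- By convention the walk stays put at an isolated vertex, so it is back at time `1`. -/
lemma avoidProb_self_of_isolated {o : W} (h : ¬ (G.neighborSet o).Nonempty) :
    G.avoidProb o o = 0 := by
  rw [← killedStep_avoidProb]
  have : G.stepKernel o = Measure.dirac o := by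
    change (G.stepLaw o).toMeasure = _
    unfold stepLaw
    rw [dif_neg (fun h' => h h'.2), PMF.toMeasure_pure]
  unfold killedStep
  rw [this, lintegral_dirac]
  simp

end SimpleGraph

end Walk

/-! ### Superharmonic functions and small cuts -/

namespace SimpleGraph

variable {W : Type*} (G : SimpleGraph W)

/-- The arcs of `G` leading out of `B`. -/
def outArcs (B : Set W) : Set (W × W) := {p | p.1 ∈ B ∧ p.2 ∉ B ∧ G.Adj p.1 p.2}

/-- Every finite set of vertices is contained in a finite set with at most `C` edges leaving it. -/
def HasSmallCuts (C : ℕ) : Prop :=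
  ∀ F : Finset W, ∃ B : Finset W, F ⊆ B ∧ (G.outArcs B).encard ≤ C

variable {G}

/-- A neighbour of `x` lies in the finite set `B` or is the head of one of the finitely many arcs
leaving `B`. -/
lemma HasSmallCuts.finite_neighborSet {C : ℕ} (h : G.HasSmallCuts C) (x : W) :
    (G.neighborSet x).Finite := by
  obtain ⟨B, hB, hC⟩ := h {x}
  have hx : x ∈ B := hB (Finset.mem_singleton_self x)
  have hfin : (G.outArcs B).Finite :=
    Set.encard_lt_top_iff.1 (hC.trans_lt (ENat.natCast_lt_top C))
  refine (B.finite_toSet.union (hfin.image Prod.snd)).subset fun y hy => ?_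
  by_cases hyB : y ∈ B
  · exact Or.inl hyB
  · exact Or.inr ⟨(x, y), ⟨hx, hyB, hy⟩, rfl⟩

open scoped Classical in
/-- There is an exhaustion by finite sets with few outgoing arcs and disjoint edge boundaries. -/
lemma HasSmallCuts.exists_exhaustion {C : ℕ} (h : G.HasSmallCuts C) (o : W) :
    ∃ B : ℕ → Finset W, Monotone B ∧ o ∈ B 0 ∧
      (∀ k y z, y ∈ B k → G.Adj y z → z ∈ B (k + 1)) ∧ ∀ k, (G.outArcs (B k)).encard ≤ C := by
  have hfin := h.finite_neighborSet
  choose b hb hbC using h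
  -- Each set is enlarged by all its neighbours before the next small cut is taken, so no edge
  -- leaves two of them.
  let B : ℕ → Finset W := fun k => Nat.rec (b {o})
    (fun _ F => b (F ∪ F.biUnion fun y => (hfin y).toFinset)) k
  have hsucc : ∀ k, B (k + 1) = b (B k ∪ (B k).biUnion fun y => (hfin y).toFinset) := fun _ => rfl
  refine ⟨B, monotone_nat_of_le_succ fun k => ?_, hb {o} (Finset.mem_singleton_self o),
    fun k y z hy hyz => ?_, fun k => ?_⟩
  · rw [hsucc]
    exact Finset.subset_union_left.trans (hb _)
  · rw [hsucc]
    refine hb _ (Finset.mem_union_right _ (Finset.mem_biUnion.2 ⟨y, hy, ?_⟩))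
    simpa using hyz
  · cases k with
    | zero => exact hbC _
    | succ k => exact hbC _

open scoped Classical in
/-- Testing a positive function `u` against `φ ^ 2 / u` is bounded by the Dirichlet energy of
`φ`. -/
lemma sum_sq_div_mul_sub_le (S : Finset W) (u φ : W → ℝ) (hu : ∀ x, 0 < u x) :
    ∑ y ∈ S, φ y ^ 2 / u y * ∑ z ∈ S with G.Adj y z, (u y - u z) ≤
      (∑ y ∈ S, ∑ z ∈ S with G.Adj y z, (φ y - φ z) ^ 2) / 2 := by
  set a : W → W → ℝ := fun y z => if G.Adj y z then φ y ^ 2 / u y * (u y - u z) else 0 with ha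
  have h1 : ∑ y ∈ S, φ y ^ 2 / u y * ∑ z ∈ S with G.Adj y z, (u y - u z) =
      ∑ y ∈ S, ∑ z ∈ S, a y z := by
    simp only [ha, Finset.sum_filter, Finset.mul_sum, mul_ite, mul_zero]
  -- Symmetrising pairs the two orientations of each edge; this is the source of the factor `1 / 2`.
  have h2 : ∑ y ∈ S, ∑ z ∈ S, a y z = ∑ y ∈ S, ∑ z ∈ S, a z y := Finset.sum_comm
  have h3 : ∑ y ∈ S, ∑ z ∈ S, a y z + ∑ y ∈ S, ∑ z ∈ S, a z y ≤
      ∑ y ∈ S, ∑ z ∈ S with G.Adj y z, (φ y - φ z) ^ 2 := by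
    simp only [← Finset.sum_add_distrib, Finset.sum_filter]
    refine Finset.sum_le_sum fun y _ => Finset.sum_le_sum fun z _ => ?_
    by_cases hyz : G.Adj y z
    · simp only [ha, if_pos hyz, if_pos hyz.symm]
      have hy := hu y
      have hz := hu z
      have : (φ y - φ z) ^ 2 - (φ y ^ 2 / u y * (u y - u z) + φ z ^ 2 / u z * (u z - u y)) =
          (φ y * u z - φ z * u y) ^ 2 / (u y * u z) := by
        field_simp
        ring
      have h4 : 0 ≤ (φ y * u z - φ z * u y) ^ 2 / (u y * u z) := by positivity
      linarith
    · have hzy : ¬ G.Adj z y := fun h => hyz h.symm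
      simp [ha, hyz, hzy]
  rw [h1]
  linarith

open scoped Classical in
/-- The energy of the function counting how many of the sets `B 0, …, B (N - 1)` contain a point. -/
lemma energy_count_le {C : ℕ} {B : ℕ → Finset W} (hmono : Monotone B)
    (hnext : ∀ k y z, y ∈ B k → G.Adj y z → z ∈ B (k + 1))
    (hC : ∀ k, (G.outArcs (B k)).encard ≤ C) (N : ℕ) (S : Finset W) (φ : W → ℝ)
    (hφ : ∀ y, φ y = ∑ k ∈ Finset.range N, if y ∈ B k then 1 else 0) :
    ∑ y ∈ S, ∑ z ∈ S with G.Adj y z, (φ y - φ z) ^ 2 ≤ 2 * C * N := by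
  set c : ℕ → W → W → ℝ := fun k y z => if y ∈ B k ∧ z ∉ B k ∧ G.Adj y z then 1 else 0 with hc
  have hpt : ∀ y z, G.Adj y z →
      (φ y - φ z) ^ 2 = ∑ k ∈ Finset.range N, (c k y z + c k z y) := by
    intro y z hyz
    set d : ℕ → ℝ := fun k => (if y ∈ B k then 1 else 0) - (if z ∈ B k then 1 else 0) with hd
    -- An edge touching `B k` lies inside every later set, so it leaves at most one level and the
    -- cross terms vanish.
    have hd0 : ∀ k l, k < l → d k * d l = 0 := by
      intro k l hkl
      have hle : B (k + 1) ⊆ B l := hmono hkl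
      have hkk : B k ⊆ B (k + 1) := hmono k.le_succ
      by_cases hy : y ∈ B k
      · have h1 := hle (hkk hy)
        have h2 := hle (hnext k y z hy hyz)
        simp [hd, h1, h2]
      · by_cases hz : z ∈ B k
        · have h1 := hle (hkk hz)
          have h2 := hle (hnext k z y hz hyz.symm)
          simp [hd, h1, h2]
        · simp [hd, hy, hz]
    have hsub : φ y - φ z = ∑ k ∈ Finset.range N, d k := by
      rw [hφ, hφ, ← Finset.sum_sub_distrib]
    rw [hsub, sq, Finset.sum_mul_sum]
    refine Finset.sum_congr rfl fun k hk => ?_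
    rw [Finset.sum_eq_single_of_mem k hk]
    · by_cases hy : y ∈ B k <;> by_cases hz : z ∈ B k <;> simp [hd, hc, hy, hz, hyz, hyz.symm]
    · intro l _ hlk
      rcases lt_or_gt_of_ne hlk with h | h
      · rw [mul_comm]; exact hd0 l k h
      · exact hd0 k l h
  have hcut : ∀ k, ∑ y ∈ S, ∑ z ∈ S, c k y z ≤ C := by
    intro k
    rw [← Finset.sum_product', hc, Finset.sum_boole]
    set A := (S ×ˢ S).filter fun p : W × W => p.1 ∈ B k ∧ p.2 ∉ B k ∧ G.Adj p.1 p.2 with hA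
    have h1 : (A : Set (W × W)) ⊆ G.outArcs (B k) := by
      intro p hp
      rw [Finset.mem_coe, hA, Finset.mem_filter] at hp
      exact hp.2
    have h2 := (Set.encard_le_encard h1).trans (hC k)
    rw [Set.encard_coe_eq_coe_finsetCard] at h2
    exact_mod_cast h2
  calc ∑ y ∈ S, ∑ z ∈ S with G.Adj y z, (φ y - φ z) ^ 2
      = ∑ y ∈ S, ∑ z ∈ S with G.Adj y z, ∑ k ∈ Finset.range N, (c k y z + c k z y) :=
        Finset.sum_congr rfl fun y _ => Finset.sum_congr rfl fun z hz =>
          hpt y z (Finset.mem_filter.1 hz).2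
    _ ≤ ∑ y ∈ S, ∑ z ∈ S, ∑ k ∈ Finset.range N, (c k y z + c k z y) := by
        refine Finset.sum_le_sum fun y _ => Finset.sum_le_sum_of_subset_of_nonneg
          (Finset.filter_subset _ _) fun z _ _ => Finset.sum_nonneg fun k _ => ?_
        simp only [hc]
        positivity
    _ = ∑ k ∈ Finset.range N, (∑ y ∈ S, ∑ z ∈ S, c k y z + ∑ y ∈ S, ∑ z ∈ S, c k z y) := by
        simp only [← Finset.sum_add_distrib]
        rw [Finset.sum_comm (s := Finset.range N)]
        exact Finset.sum_congr rfl fun y _ => Finset.sum_comm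
    _ ≤ ∑ _k ∈ Finset.range N, (C + C : ℝ) := by
        refine Finset.sum_le_sum fun k _ => add_le_add (hcut k) ?_
        rw [Finset.sum_comm]
        exact hcut k
    _ = 2 * C * N := by simp; ring

open scoped Classical in
/-- In a graph with small cuts, positive superharmonic functions are harmonic. -/
lemma HasSmallCuts.harmonic_of_superharmonic {C : ℕ} (h : G.HasSmallCuts C) (u : W → ℝ)
    (hu : ∀ x, 0 < u x)
    (hsuper : ∀ x, 0 ≤ ∑ z ∈ (h.finite_neighborSet x).toFinset, (u x - u z)) (o : W) :
    ∑ z ∈ (h.finite_neighborSet o).toFinset, (u o - u z) = 0 := by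
  obtain ⟨B, hmono, ho, hnext, hC⟩ := h.exists_exhaustion o
  set D : W → ℝ := fun x => ∑ z ∈ (h.finite_neighborSet x).toFinset, (u x - u z) with hD
  have key : ∀ N : ℕ, (N : ℝ) * D o ≤ C * u o := by
    intro N
    rcases Nat.eq_zero_or_pos N with rfl | hN
    · simpa using mul_nonneg (Nat.cast_nonneg C) (hu o).le
    have hoB : ∀ k, o ∈ B k := fun k => hmono (Nat.zero_le k) ho
    set φ : W → ℝ := fun y => ∑ k ∈ Finset.range N, if y ∈ B k then 1 else 0 with hφ
    have h1 := sum_sq_div_mul_sub_le (G := G) (B N) u φ hu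
    have h2 := energy_count_le hmono hnext hC N (B N) φ (fun _ => rfl)
    -- Where `φ` is nonzero, all neighbours lie in `B N`, so the truncated sum is the full
    -- Laplacian.
    have h3 : ∀ y, φ y ^ 2 / u y * ∑ z ∈ B N with G.Adj y z, (u y - u z) =
        φ y ^ 2 / u y * D y := by
      intro y
      by_cases hy : ∃ k ∈ Finset.range N, y ∈ B k
      · obtain ⟨k, hk, hyk⟩ := hy
        congr 2
        ext z
        simp only [Finset.mem_filter, Set.Finite.mem_toFinset, mem_neighborSet,
          and_iff_right_iff_imp]
        exact fun hyz => hmono (Finset.mem_range.1 hk) (hnext k y z hyk hyz)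
      · push Not at hy
        have : φ y = 0 := Finset.sum_eq_zero fun k hk => if_neg (hy k hk)
        simp [this]
    have h4 : φ o ^ 2 / u o * D o ≤ ∑ y ∈ B N, φ y ^ 2 / u y * D y :=
      Finset.single_le_sum (f := fun y => φ y ^ 2 / u y * D y)
        (fun y _ => mul_nonneg (div_nonneg (sq_nonneg _) (hu y).le) (hsuper y)) (hoB N)
    have h5 : φ o = N := by simp [hφ, hoB]
    simp only [h3] at h1
    rw [h5] at h4
    have h6 : (N : ℝ) ^ 2 / u o * D o ≤ C * N := by linarith
    have hN' : (0 : ℝ) < N := Nat.cast_pos.2 hN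
    have huo := hu o
    rw [div_mul_eq_mul_div, div_le_iff₀ huo] at h6
    nlinarith
  by_contra hne
  have hpos : 0 < D o := lt_of_le_of_ne (hsuper o) (Ne.symm hne)
  obtain ⟨N, hN⟩ := exists_nat_gt (C * u o / D o)
  rw [div_lt_iff₀ hpos] at hN
  exact absurd (key N) (not_le.2 hN)

/-- A form of the Nash-Williams criterion: a graph with small cuts is recurrent. -/
theorem HasSmallCuts.clusterRecurrent [MeasurableSpace W] [DiscreteMeasurableSpace W] {C : ℕ}
    (h : G.HasSmallCuts C) (o : W) : G.ClusterRecurrent o := by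
  classical
  refine ⟨fun y _ => h.finite_neighborSet y, G.ae_return_of_avoidProb_eq_zero ?_⟩
  by_cases hne : (G.neighborSet o).Nonempty
  swap
  · exact G.avoidProb_self_of_isolated hne
  have hfin : ∀ x, G.avoidProb o x ≠ ⊤ := fun x =>
    ((G.avoidProb_le_one o x).trans_lt ENNReal.one_lt_top).ne
  set v : W → ℝ := fun x => (G.avoidProb o x).toReal with hv
  have hv0 : ∀ x, 0 ≤ v x := fun x => ENNReal.toReal_nonneg
  have hv1 : ∀ x, v x ≤ 1 := fun x => by
    simpa using ENNReal.toReal_mono ENNReal.one_ne_top (G.avoidProb_le_one o x)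
  -- The fixed-point equation of `killedStep_avoidProb`, multiplied by the degree.
  have hsum : ∀ x, ∑ z ∈ (h.finite_neighborSet x).toFinset, (v x - if z = o then 0 else v z) =
      0 := by
    intro x
    by_cases hx : (G.neighborSet x).Nonempty
    · have h1 := G.lintegral_stepKernel (h.finite_neighborSet x) hx
        (({o}ᶜ : Set W).indicator (G.avoidProb o))
      change _ * G.killedStep o (G.avoidProb o) x = _ at h1
      rw [killedStep_avoidProb] at h1
      have h2 := congrArg ENNReal.toReal h1
      rw [ENNReal.toReal_mul, ENNReal.toReal_natCast, ENNReal.toReal_sum] at h2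
      · rw [Finset.sum_sub_distrib, Finset.sum_const, nsmul_eq_mul, h2, sub_eq_zero]
        refine Finset.sum_congr rfl fun z _ => ?_
        by_cases hz : z = o <;> simp [hz, hv]
      · intro z _
        by_cases hz : z = o <;> simp [hz, hfin]
    · rw [Set.not_nonempty_iff_eq_empty] at hx
      simp [hx]
  -- Since `v ≤ 1`, the constant `2` keeps `u` positive. The Laplacian of `u` vanishes off `o`.
  set u : W → ℝ := fun x => 2 - if x = o then 0 else v x with hu
  have hsub : ∀ x z, u x - u z = (v x - if x = o then 0 else v x) -
      (v x - if z = o then 0 else v z) := fun x z => by simp only [hu]; ring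
  have hD : ∀ x, ∑ z ∈ (h.finite_neighborSet x).toFinset, (u x - u z) =
      (h.finite_neighborSet x).toFinset.card * (v x - if x = o then 0 else v x) := by
    intro x
    simp only [hsub]
    rw [Finset.sum_sub_distrib, hsum, sub_zero, Finset.sum_const, nsmul_eq_mul]
  have hharm := h.harmonic_of_superharmonic u
    (fun x => by
      simp only [hu]
      split_ifs
      · norm_num
      · linarith [hv1 x])
    (fun x => by
      rw [hD]
      refine mul_nonneg (Nat.cast_nonneg _) ?_
      split_ifs
      · simpa using hv0 x
      · simp) o
  rw [hD, if_pos rfl, sub_zero, mul_eq_zero] at hharm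
  rcases hharm with h0 | h0
  · rw [Nat.cast_eq_zero, Finset.card_eq_zero, Set.Finite.toFinset_eq_empty] at h0
    exact absurd h0 hne.ne_empty
  · exact (ENNReal.toReal_eq_zero_iff _).1 h0 |>.resolve_right (hfin o)

end SimpleGraph

/-! ### Crossings of geometric graphs -/

namespace GeometricGraph

/-- The arcs `(x, y)` of `g` with `x ≤ t < y`. -/
def arcsAcross (g : GeometricGraph) (t : ℝ) : Set (ℝ × ℝ) := g.arcs ∩ {p | p.1 ≤ t ∧ t < p.2}

/-- The number of edges of `g` above `t+`. -/
noncomputable def crossingsAt (g : GeometricGraph) (t : ℝ) : ℕ∞ := (g.arcsAcross t).encard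

lemma mem_arcsAcross {g : GeometricGraph} {t : ℝ} {p : ℝ × ℝ} :
    p ∈ g.arcsAcross t ↔ g.graph.Adj p.1 p.2 ∧ p.1 ≤ t ∧ t < p.2 := Iff.rfl

lemma crossings_eq_crossingsAt (g : GeometricGraph) : g.crossings = g.crossingsAt 0 := by
  unfold crossings crossingsAt
  congr 1
  ext p
  exact ⟨fun h => ⟨h.2.2, h.1, h.2.1⟩, fun h => ⟨h.2.1, h.2.2, h.1⟩⟩

lemma measurableSet_crossingsAt_mem (t : ℝ) (s : Set ℕ∞) :
    MeasurableSet {g : GeometricGraph | g.crossingsAt t ∈ s} := by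
  have hm : MeasurableSet {p : ℝ × ℝ | p.1 ≤ t ∧ t < p.2} :=
    (measurableSet_le measurable_fst measurable_const).inter
      (measurableSet_lt measurable_const measurable_snd)
  refine (le_sup_right : _ ≤ instMeasurableSpace) _ ?_
  exact (le_iSup₂_of_le (f := fun (B : Set (ℝ × ℝ)) (_ : MeasurableSet B) =>
    MeasurableSpace.comap (fun g : GeometricGraph => (g.arcs ∩ B).encard) ⊤) _ hm le_rfl) _
    ⟨s, trivial, rfl⟩

lemma measurableSet_crossingsAt_le (t : ℝ) (M : ℕ∞) :
    MeasurableSet {g : GeometricGraph | g.crossingsAt t ≤ M} :=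
  measurableSet_crossingsAt_mem t (Set.Iic M)

lemma measurableSet_encard_verts_inter_mem {A : Set ℝ} (hA : MeasurableSet A) (s : Set ℕ∞) :
    MeasurableSet {g : GeometricGraph | (g.verts ∩ A).encard ∈ s} := by
  refine (le_sup_left : _ ≤ instMeasurableSpace) _ ?_
  exact (le_iSup₂_of_le (f := fun (A : Set ℝ) (_ : MeasurableSet A) =>
    MeasurableSpace.comap (fun g : GeometricGraph => (g.verts ∩ A).encard) ⊤) _ hA le_rfl) _
    ⟨s, trivial, rfl⟩

lemma locallyFiniteVerts_iff (g : GeometricGraph) :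
    g.LocallyFiniteVerts ↔ ∀ n : ℕ, (g.verts ∩ Set.Icc (-n : ℝ) n).encard < ⊤ := by
  simp only [Set.encard_lt_top_iff]
  refine ⟨fun h n => h _ _, fun h a b => ?_⟩
  obtain ⟨n, hn⟩ := exists_nat_gt (max |a| |b|)
  refine (h n).subset (Set.inter_subset_inter_right _ (Set.Icc_subset_Icc ?_ ?_))
  · linarith [neg_abs_le a, le_max_left |a| |b|]
  · linarith [le_abs_self b, le_max_right |a| |b|]

lemma measurableSet_locallyFiniteVerts :
    MeasurableSet {g : GeometricGraph | g.LocallyFiniteVerts} := by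
  simp only [locallyFiniteVerts_iff]
  rw [Set.ofPred_forall]
  exact MeasurableSet.iInter fun n =>
    measurableSet_encard_verts_inter_mem measurableSet_Icc (Set.Iio ⊤)

/-- The crossing number is locally constant from the right. -/
lemma LocallyFiniteVerts.exists_rat_crossingsAt_eq {g : GeometricGraph} (h : g.LocallyFiniteVerts)
    {t s : ℝ} (hts : t < s) : ∃ q : ℚ, t < q ∧ (q : ℝ) < s ∧ g.crossingsAt q = g.crossingsAt t := by
  -- The interval omits `t`: a vertex at `t` itself does no harm, as crossings are counted with `p.1
  -- ≤ t < p.2`.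
  have hfin : (g.verts ∩ Set.Ioc t s).Finite :=
    (h t s).subset (Set.inter_subset_inter_right _ Set.Ioc_subset_Icc_self)
  have hmem : (g.verts ∩ Set.Ioc t s)ᶜ ∈ nhds t :=
    hfin.isClosed.isOpen_compl.mem_nhds fun ht => lt_irrefl _ ht.2.1
  obtain ⟨ε, hε, hball⟩ := Metric.mem_nhds_iff.1 hmem
  obtain ⟨q, htq, hq⟩ := exists_rat_btwn (lt_min hts (lt_add_of_pos_right t hε))
  rw [lt_min_iff] at hq
  have hno : ∀ v ∈ g.verts, v ≤ q ↔ v ≤ t := by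
    refine fun v hv => ⟨fun hvq => ?_, fun hvt => hvt.trans htq.le⟩
    by_contra! hvt
    refine (hball ?_ : v ∈ _) ⟨hv, hvt, hvq.trans hq.1.le⟩
    rw [Metric.mem_ball, Real.dist_eq, abs_lt]
    constructor <;> linarith [hq.2]
  refine ⟨q, htq, hq.1, ?_⟩
  unfold crossingsAt
  congr 1
  ext p
  simp only [mem_arcsAcross]
  refine and_congr_right fun hp => and_congr (hno _ (g.mem_of_adj _ _ hp)) ?_
  rw [← not_le, ← not_le, hno _ (g.mem_of_adj _ _ hp.symm)]

/-! ### Translations and the invariant event of thin places -/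

lemma crossingsAt_translate (h : ℝ) (g : GeometricGraph) (t : ℝ) :
    (translate h g).crossingsAt t = g.crossingsAt (t - h) := by
  have hinj : Function.Injective fun p : ℝ × ℝ => (p.1 + h, p.2 + h) := fun p q hpq => by
    simpa [Prod.ext_iff] using hpq
  unfold crossingsAt
  rw [← hinj.encard_image (g.arcsAcross (t - h))]
  congr 1
  ext p
  constructor
  · rintro ⟨h1, h2, h3⟩
    exact ⟨(p.1 - h, p.2 - h), ⟨h1, sub_le_sub_right h2 h, sub_lt_sub_right h3 h⟩, by simp⟩
  · rintro ⟨⟨x, y⟩, ⟨h1, h2, h3⟩, rfl⟩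
    refine ⟨?_, le_sub_iff_add_le.1 h2, sub_lt_iff_lt_add.1 h3⟩
    change g.graph.Adj (x + h - h) (y + h - h)
    rwa [add_sub_cancel_right, add_sub_cancel_right]

lemma crossingsAt_iterate_translate (h : ℝ) (n : ℕ) (g : GeometricGraph) (t : ℝ) :
    ((translate h)^[n] g).crossingsAt t = g.crossingsAt (t - n * h) := by
  induction n generalizing t with
  | zero => simp
  | succ n ih =>
    rw [Function.iterate_succ_apply', crossingsAt_translate, ih]
    congr 1
    push_cast
    ring

lemma LocallyFiniteVerts.translate {g : GeometricGraph} (hg : g.LocallyFiniteVerts) (h : ℝ) :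
    (translate h g).LocallyFiniteVerts := fun a b => by
  refine ((hg (a - h) (b - h)).image (· + h)).subset fun x hx => ⟨x - h, ⟨hx.1, ?_, ?_⟩, by simp⟩
  · linarith [hx.2.1]
  · linarith [hx.2.2]

lemma translate_neg_translate (h : ℝ) (g : GeometricGraph) :
    GeometricGraph.translate (-h) (GeometricGraph.translate h g) = g := by
  obtain ⟨V, hV, E, hE⟩ := g
  simp only [GeometricGraph.translate, mk.injEq]
  constructor
  · ext x; simp
  · ext x y; simp

/-- The vertex set is locally finite, and the crossing numbers are bounded along sequences of points
tending to `∞` and to `-∞`. -/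
def HasThinPlaces (g : GeometricGraph) : Prop :=
  g.LocallyFiniteVerts ∧ ∃ M : ℕ, ∀ n : ℕ,
    (∃ t : ℝ, n < t ∧ g.crossingsAt t ≤ M) ∧ ∃ t : ℝ, t < -n ∧ g.crossingsAt t ≤ M

/-- Right-continuity of the crossing number makes the quantifiers countable, which yields
measurability. -/
lemma hasThinPlaces_iff_rat (g : GeometricGraph) : g.HasThinPlaces ↔
    g.LocallyFiniteVerts ∧ ∃ M : ℕ, ∀ n : ℕ,
      (∃ q : ℚ, (n : ℝ) < q ∧ g.crossingsAt q ≤ M) ∧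
        ∃ q : ℚ, (q : ℝ) < -n ∧ g.crossingsAt q ≤ M := by
  refine and_congr_right fun hg => exists_congr fun M => forall_congr' fun n => and_congr ?_ ?_
  · refine ⟨fun ⟨t, ht, htM⟩ => ?_, fun ⟨q, hq, hqM⟩ => ⟨q, hq, hqM⟩⟩
    obtain ⟨q, hq, -, hqt⟩ := hg.exists_rat_crossingsAt_eq (lt_add_one t)
    exact ⟨q, ht.trans hq, hqt ▸ htM⟩
  · refine ⟨fun ⟨t, ht, htM⟩ => ?_, fun ⟨q, hq, hqM⟩ => ⟨q, hq, hqM⟩⟩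
    obtain ⟨q, -, hq, hqt⟩ := hg.exists_rat_crossingsAt_eq ht
    exact ⟨q, hq, hqt ▸ htM⟩

lemma measurableSet_hasThinPlaces : MeasurableSet {g : GeometricGraph | g.HasThinPlaces} := by
  simp only [hasThinPlaces_iff_rat]
  rw [Set.ofPred_and]
  refine measurableSet_locallyFiniteVerts.inter ?_
  simp only [Set.ofPred_exists, Set.ofPred_forall, Set.ofPred_and]
  exact MeasurableSet.iUnion fun M => MeasurableSet.iInter fun n =>
    (MeasurableSet.iUnion fun q => (MeasurableSet.const _).inter
      (measurableSet_crossingsAt_le _ _)).inter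
    (MeasurableSet.iUnion fun q => (MeasurableSet.const _).inter
      (measurableSet_crossingsAt_le _ _))

lemma HasThinPlaces.translate {g : GeometricGraph} (hg : g.HasThinPlaces) (h : ℝ) :
    (translate h g).HasThinPlaces := by
  obtain ⟨hfin, M, hM⟩ := hg
  refine ⟨hfin.translate h, M, fun n => ?_⟩
  obtain ⟨m, hm⟩ := exists_nat_gt (n + |h|)
  obtain ⟨⟨t, ht, htM⟩, s, hs, hsM⟩ := hM m
  refine ⟨⟨t + h, ?_, ?_⟩, s + h, ?_, ?_⟩
  · linarith [neg_abs_le h]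
  · rwa [crossingsAt_translate, add_sub_cancel_right]
  · linarith [le_abs_self h]
  · rwa [crossingsAt_translate, add_sub_cancel_right]

lemma preimage_translate_hasThinPlaces (h : ℝ) :
    GeometricGraph.translate h ⁻¹' {g | g.HasThinPlaces} = {g | g.HasThinPlaces} := by
  ext g
  refine ⟨fun hg => ?_, fun hg => HasThinPlaces.translate hg h⟩
  have := HasThinPlaces.translate hg (-h)
  rwa [translate_neg_translate] at this

/-- Take the vertices in `(s, t]` with `s` and `t` thin places on either side of `F`: an edge
leaving this set crosses `s` or `t`. -/
lemma HasThinPlaces.hasSmallCuts {g : GeometricGraph} (hg : g.HasThinPlaces) :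
    ∃ C : ℕ, (g.graph.induce g.verts).HasSmallCuts C := by
  obtain ⟨hfin, M, hM⟩ := hg
  refine ⟨M + M, fun F => ?_⟩
  obtain ⟨n, hn⟩ : ∃ n : ℕ, ∀ x ∈ F, |(x : ℝ)| ≤ n := by
    obtain ⟨c, hc⟩ := (F.image fun x : g.verts => |(x : ℝ)|).bddAbove
    obtain ⟨n, hn⟩ := exists_nat_ge c
    exact ⟨n, fun x hx => (hc (Finset.mem_coe.2 (Finset.mem_image_of_mem _ hx))).trans hn⟩
  obtain ⟨⟨t, ht, htM⟩, s, hs, hsM⟩ := hM n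
  have hB : {x : g.verts | s < x ∧ (x : ℝ) ≤ t}.Finite := by
    refine Set.Finite.of_finite_image ((hfin s t).subset ?_) Subtype.val_injective.injOn
    rintro _ ⟨x, hx, rfl⟩
    exact ⟨x.2, hx.1.le, hx.2⟩
  refine ⟨hB.toFinset, fun x hx => ?_, ?_⟩
  · rw [Set.Finite.mem_toFinset]
    have := abs_le.1 (hn x hx)
    exact ⟨by linarith, by linarith⟩
  · have hinj : Function.Injective fun p : g.verts × g.verts => ((p.1 : ℝ), (p.2 : ℝ)) :=
      Subtype.val_injective.prodMap Subtype.val_injective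
    rw [← hinj.encard_image]
    have hsub : (fun p : g.verts × g.verts => ((p.1 : ℝ), (p.2 : ℝ))) ''
        (g.graph.induce g.verts).outArcs hB.toFinset ⊆
        g.arcsAcross t ∪ Prod.swap '' g.arcsAcross s := by
      rintro _ ⟨⟨x, y⟩, ⟨hx, hy, hxy⟩, rfl⟩
      rw [Finset.mem_coe, Set.Finite.mem_toFinset] at hx hy
      have hadj : g.graph.Adj x y := hxy
      rcases lt_or_ge s (y : ℝ) with hsy | hsy
      · exact Or.inl ⟨hadj, hx.2, not_le.1 fun h => hy ⟨hsy, h⟩⟩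
      · exact Or.inr ⟨(y, x), ⟨hadj.symm, hsy, hx.1⟩, rfl⟩
    refine (Set.encard_le_encard hsub).trans ((Set.encard_union_le _ _).trans ?_)
    rw [Prod.swap_injective.encard_image]
    push_cast
    exact add_le_add htM hsM

lemma HasThinPlaces.allClustersRecurrent {g : GeometricGraph} (hg : g.HasThinPlaces) :
    g.AllClustersRecurrent := fun x => by
  obtain ⟨C, hC⟩ := hg.hasSmallCuts
  exact hC.clusterRecurrent x

/-- A measure preserving translation brings almost every graph with few crossings back, infinitely
often, to having few crossings. -/
lemma ae_frequently_crossingsAt_le (ν : Measure GeometricGraph) [IsFiniteMeasure ν] {h : ℝ}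
    (hh : MeasurePreserving (translate h) ν ν) (M : ℕ∞) :
    ∀ᵐ g ∂ν, g.crossingsAt 0 ≤ M →
      ∃ᶠ n : ℕ in Filter.atTop, g.crossingsAt (-(n * h)) ≤ M := by
  filter_upwards [hh.conservative.ae_mem_imp_frequently_image_mem
    (measurableSet_crossingsAt_le 0 M).nullMeasurableSet] with g hg hgM
  refine (hg hgM).mono fun n hn => ?_
  have : ((GeometricGraph.translate h)^[n] g).crossingsAt 0 ≤ M := hn
  rwa [crossingsAt_iterate_translate, zero_sub] at this

lemma ae_hasThinPlaces (ν : Measure GeometricGraph) [IsProbabilityMeasure ν]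
    (hfin : ∀ᵐ g ∂ν, g.LocallyFiniteVerts) {H : AddSubgroup ℝ} (hH : H ≠ ⊥)
    (hinv : TranslationInvariant H ν) (herg : TranslationErgodic H ν)
    (hX : ν {g | g.crossings < ⊤} ≠ 0) : ∀ᵐ g ∂ν, g.HasThinPlaces := by
  obtain ⟨h, hhH, hpos⟩ : ∃ h ∈ H, 0 < h := by
    obtain ⟨h, hhH, hne⟩ := H.bot_or_exists_ne_zero.resolve_left hH
    rcases lt_or_gt_of_ne hne with hneg | hpos
    · exact ⟨-h, H.neg_mem hhH, neg_pos.2 hneg⟩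
    · exact ⟨h, hhH, hpos⟩
  obtain ⟨M, hM⟩ : ∃ M : ℕ, ν {g | g.crossingsAt 0 ≤ M} ≠ 0 := by
    by_contra! hcon
    refine hX (measure_mono_null (fun g hg => ?_) (measure_iUnion_null hcon))
    have hlt : g.crossingsAt 0 < ⊤ := g.crossings_eq_crossingsAt ▸ hg
    exact Set.mem_iUnion.2 ⟨(g.crossingsAt 0).toNat, (ENat.natCast_toNat hlt.ne).ge⟩
  have hae : ∀ᵐ g ∂ν, g.crossingsAt 0 ≤ (M : ℕ∞) → g.HasThinPlaces := by
    filter_upwards [hfin, ae_frequently_crossingsAt_le ν (hinv h hhH) M,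
      ae_frequently_crossingsAt_le ν (hinv (-h) (H.neg_mem hhH)) M] with g hg h1 h2 hgM
    refine ⟨hg, M, fun n => ?_⟩
    obtain ⟨m, hm⟩ := exists_nat_gt (n / h)
    rw [div_lt_iff₀ hpos] at hm
    have hlarge : ∀ k : ℕ, m ≤ k → (n : ℝ) < k * h := fun k hk =>
      hm.trans_le (mul_le_mul_of_nonneg_right (Nat.cast_le.2 hk) hpos.le)
    -- Translating the graph by `-h` inspects points further right, translating by `h` points
    -- further left.
    obtain ⟨k, hk, hkM⟩ := Filter.frequently_atTop.1 (h2 hgM) m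
    obtain ⟨l, hl, hlM⟩ := Filter.frequently_atTop.1 (h1 hgM) m
    exact ⟨⟨_, by simpa using hlarge k hk, hkM⟩, ⟨_, neg_lt_neg (hlarge l hl), hlM⟩⟩
  -- Recurrence only gives positive probability; ergodicity raises it to one.
  have hne : ν {g | g.HasThinPlaces} ≠ 0 := fun h0 =>
    hM (nonpos_iff_eq_zero.1 ((measure_mono_ae hae).trans_eq h0))
  have hone := (herg _ measurableSet_hasThinPlaces
    fun h _ => preimage_translate_hasThinPlaces h).resolve_left hne
  exact (prob_compl_eq_zero_iff measurableSet_hasThinPlaces).2 hone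

end GeometricGraph

theorem mainTheorem2 {Ω : Type*} [MeasurableSpace Ω] (P : Measure Ω) [IsProbabilityMeasure P]
    (G : Ω → GeometricGraph) (hG : Measurable G)
    (hfin : ∀ᵐ ω ∂P, (G ω).LocallyFiniteVerts)
    (H : AddSubgroup ℝ) (hH : H ≠ ⊥)
    (hinv : GeometricGraph.TranslationInvariant H (P.map G))
    (herg : GeometricGraph.TranslationErgodic H (P.map G))
    (hX : 0 < P {ω | (G ω).crossings < ⊤}) :
    ∀ᵐ ω ∂P, (G ω).AllClustersRecurrent := by
  have : IsProbabilityMeasure (P.map G) := Measure.isProbabilityMeasure_map hG.aemeasurable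
  have hfin' : ∀ᵐ g ∂(P.map G), g.LocallyFiniteVerts :=
    (ae_map_iff hG.aemeasurable GeometricGraph.measurableSet_locallyFiniteVerts).2 hfin
  have hX' : (P.map G) {g | g.crossings < ⊤} ≠ 0 :=
    (hX.trans_le (Measure.le_map_apply hG.aemeasurable _)).ne'
  -- Recurrence of all clusters is deduced pointwise from the measurable event of thin places, so
  -- its own measurability is not needed.
  filter_upwards [ae_of_ae_map hG.aemeasurable
    (GeometricGraph.ae_hasThinPlaces (P.map G) hfin' hH hinv herg hX')] with ω hω
  exact hω.allClustersRecurrent
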